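/- Let $m\ge 2$ be an integer, let $\varepsilon>0$ and $T>0$, and let $\Omega=[-\tfrac12,\tfrac12]^m$ with periodic boundary condition. Let $\mathcal X$ be the Banach space of periodic continuous functions $W:\overline\Omega\to\mathbb R^{m\times m}$ (that is, continuous functions on the torus $\mathbb R^m/\mathbb Z^m$) with the norm $\|W\|_{\mathcal X}=\max_{\mathbf x\in\overline\Omega}\|W(\mathbf x)\|_F$, where $\|\cdot\|_F$ is the Frobenius norm, and let $\mathcal X_m=\{W\in\mathcal X:\ \|W(\mathbf x)\|_F\le\sqrt m\ \text{for all } \mathbf x\in\overline\Omega\}$. For $V\in\mathbb R^{m\times m}$ put $$f(V)=V-VV^{\mathsf T}V,\qquad \mathcal N[V]=\kappa V+f(V).$$ Suppose that $U_0\in\mathcal X_m$ and $\kappa\ge\max\{\tfrac32m-1,\,2\}$. Then the matrix-valued Allen--Cahn equation $$U_t+\kappa U=\varepsilon^2\Delta U+\mathcal N[U],\qquad U|_{t=0}=U_0,$$ with periodic boundary condition has a unique mild solution $U\in C([0,T];\mathcal X_m)$, that is, there is exactly one $U\in C([0,T];\mathcal X_m)$ such that, for all $t\in[0,T]$ and $\mathbf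 x\in\overline\Omega$, $$U(t,\mathbf x)=\bigl(e^{t(\varepsilon^2\Delta-\kappa)}U_0\bigr)(\mathbf x)+\int_0^t\bigl(e^{(t-s)(\varepsilon^2\Delta-\kappa)}\mathcal N[U(s)]\bigr)(\mathbf x)\,ds .$$ Here $e^{t(\varepsilon^2\Delta-\kappa)}=e^{-\kappa t}e^{t\varepsilon^2\Delta}$, and $e^{t\varepsilon^2\Delta}$ is the solution operator of the heat equation $w_t=\varepsilon^2\Delta w$ with periodic boundary condition, i.e. the identity for $t=0$ and, for $t>0$, convolution on $\mathbb R^m$ of the periodic function with $(4\pi\varepsilon^2t)^{-m/2}e^{-|\mathbf y|^2/(4\varepsilon^2t)}$. In particular, $\|U(t,\mathbf x)\|_F\le\sqrt m$ for all $t\in[0,T]$ and $\mathbf x\in\overline\Omega$. -/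

import Mathlib

open scoped Matrix.Norms.Frobenius

noncomputable section

namespace MatrixAllenCahn

/-- Real `m × m` matrices. The opened scope `Matrix.Norms.Frobenius` makes `‖A‖` the Frobenius
norm of `A : Mat m`. -/
abbrev Mat (m : ℕ) : Type := Matrix (Fin m) (Fin m) ℝ

/-- The Banach space of continuous matrix fields on the cube `[-1/2, 1/2]^m` that satisfy the
periodic boundary condition, realised as continuous functions on the torus `(ℝ / ℤ)^m`, with the
supremum norm `max_x ‖W x‖_F`. Continuity is with respect to the topology of the Frobenius norm. -/
abbrev PeriodicField (m : ℕ) : Type :=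
  @ContinuousMap (UnitAddTorus (Fin m)) (Mat m) _
    (PseudoMetricSpace.toUniformSpace (α := Mat m)).toTopologicalSpace

/-- The set of fields with `‖W x‖_F ≤ √m` at every point. -/
def boundedFields (m : ℕ) : Set (PeriodicField m) := {W | ∀ x, ‖W x‖ ≤ Real.sqrt m}

/-- `f(V) = V - V Vᵀ V`. -/
def reaction {m : ℕ} (V : Mat m) : Mat m := V - V * V.transpose * V

/-- `N[V] = κ V + f(V)`. -/
def stabilizedReaction {m : ℕ} (κ : ℝ) (V : Mat m) : Mat m := κ • V + reaction V

/-- The point of the torus represented by `y ∈ ℝ^m`. -/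
def toTorus {m : ℕ} (y : EuclideanSpace ℝ (Fin m)) : UnitAddTorus (Fin m) :=
  fun i => (y i : UnitAddCircle)

/-- The fundamental solution `(4πε²t)^(-m/2) exp(-|y|² / (4ε²t))` of `∂ₜ w = ε² Δ w` on `ℝ^m`. -/
def heatKernel (m : ℕ) (ε t : ℝ) (y : EuclideanSpace ℝ (Fin m)) : ℝ :=
  (4 * Real.pi * ε ^ 2 * t) ^ (-(m : ℝ) / 2) * Real.exp (-‖y‖ ^ 2 / (4 * ε ^ 2 * t))

/-- The fundamental solution has total mass one. -/
theorem integral_heatKernel (m : ℕ) {ε t : ℝ} (hε : 0 < ε) (ht : 0 < t) :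
    ∫ y, heatKernel m ε t y = 1 := by
  have hb : 0 < 1 / (4 * ε ^ 2 * t) := by positivity
  have hpos : 0 < 4 * Real.pi * ε ^ 2 * t := by positivity
  have h := GaussianFourier.integral_rexp_neg_mul_sq_norm (V := EuclideanSpace ℝ (Fin m)) hb
  unfold heatKernel
  rw [MeasureTheory.integral_const_mul]
  have h1 : ∀ y : EuclideanSpace ℝ (Fin m), -‖y‖ ^ 2 / (4 * ε ^ 2 * t)
      = -(1 / (4 * ε ^ 2 * t)) * ‖y‖ ^ 2 := fun y => by ring
  simp_rw [h1]
  rw [h, finrank_euclideanSpace_fin,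
    show Real.pi / (1 / (4 * ε ^ 2 * t)) = 4 * Real.pi * ε ^ 2 * t by field_simp,
    ← Real.rpow_add hpos, show -(m : ℝ) / 2 + m / 2 = 0 by ring, Real.rpow_zero]

open Laplacian InnerProductSpace in
/-- The fundamental solution satisfies the heat equation `∂ₜ w = ε² Δ w`. -/
theorem hasDerivAt_heatKernel (m : ℕ) {ε t : ℝ} (hε : 0 < ε) (ht : 0 < t)
    (y : EuclideanSpace ℝ (Fin m)) :
    HasDerivAt (fun τ => heatKernel m ε τ y) (ε ^ 2 * Δ (heatKernel m ε t) y) t := by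
  have hpos : 0 < 4 * Real.pi * ε ^ 2 * t := by positivity
  set c : ℝ := -1 / (4 * ε ^ 2 * t) with hc
  set A : ℝ := (4 * Real.pi * ε ^ 2 * t) ^ (-(m : ℝ) / 2) with hA
  have hK : heatKernel m ε t = fun z => A * Real.exp (c * ‖z‖ ^ 2) := by
    funext z
    simp only [heatKernel, ← hA, hc]
    congr 2
    ring
  have hd1 : ∀ z, HasFDerivAt (heatKernel m ε t)
      ((A * Real.exp (c * ‖z‖ ^ 2) * (2 * c)) • innerSL ℝ z) z := by
    intro z
    rw [hK]
    have h2 := ((((hasStrictFDerivAt_norm_sq z).hasFDerivAt).const_mul c).exp).const_mul A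
    refine h2.congr_fderiv ?_
    ext v
    simp
    ring
  have hf1 : fderiv ℝ (heatKernel m ε t)
      = fun z => (2 * c * heatKernel m ε t z) • innerSL ℝ z := by
    funext z
    rw [(hd1 z).fderiv, hK]
    congr 1
    ring
  have hd2 : ∀ v : EuclideanSpace ℝ (Fin m), fderiv ℝ (fderiv ℝ (heatKernel m ε t)) y v v
      = 2 * c * heatKernel m ε t y * (2 * c * inner ℝ y v ^ 2 + inner ℝ v v) := by
    intro v
    have h3 := ((hd1 y).const_mul (2 * c)).smul ((innerSL ℝ).hasFDerivAt (x := y))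
    have h5 := h3.fderiv
    rw [hf1]
    change fderiv ℝ (fun z => (2 * c * heatKernel m ε t z) • innerSL ℝ z) y = _ at h5
    rw [h5]
    have hi : ∀ u w : EuclideanSpace ℝ (Fin m), (innerSL ℝ u) w = inner ℝ u w := fun _ _ => rfl
    simp [hK, hi, -coe_innerSL_apply]
    ring
  have hlap : Δ (heatKernel m ε t) y
      = 2 * c * heatKernel m ε t y * (2 * c * ‖y‖ ^ 2 + m) := by
    rw [laplacian_eq_iteratedFDeriv_orthonormalBasis _ (EuclideanSpace.basisFun (Fin m) ℝ)]
    simp only [iteratedFDeriv_two_apply, Matrix.cons_val_zero, Matrix.cons_val_one, hd2]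
    rw [← Finset.mul_sum, Finset.sum_add_distrib, ← Finset.mul_sum,
      OrthonormalBasis.sum_sq_inner_left]
    simp
  have ht1 := (((hasDerivAt_id t).const_mul (4 * Real.pi * ε ^ 2)).rpow_const
    (p := -(m : ℝ) / 2) (Or.inl (by simpa using hpos.ne')))
  have ht2 := ((((hasDerivAt_id t).const_mul (4 * ε ^ 2)).inv
    (by simp [hε.ne', ht.ne'])).const_mul (-‖y‖ ^ 2)).exp
  have h4 := ht1.mul ht2
  refine HasDerivAt.congr_deriv (f := fun τ => heatKernel m ε τ y) (h4.congr_of_eventuallyEq ?_) ?_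
  · filter_upwards with τ
    simp [heatKernel, div_eq_mul_inv]
  · rw [hlap]
    simp only [id]
    rw [Real.rpow_sub_one (by simpa using hpos.ne')]
    simp only [heatKernel, hc, Pi.inv_apply, ← div_eq_mul_inv]
    generalize hE : Real.exp (-‖y‖ ^ 2 / (4 * ε ^ 2 * t)) = E
    field_simp
    ring

/-- The solution operator `e^{t ε² Δ}` of `∂ₜ w = ε² Δ w` with periodic boundary condition, for
`t ≥ 0`: the identity at `t = 0`, and for `t > 0` the convolution on `ℝ^m` of the periodic field `W`
with the fundamental solution. -/
def heatFlow {m : ℕ} (ε t : ℝ) (W : UnitAddTorus (Fin m) → Mat m) (x : UnitAddTorus (Fin m)) :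
    Mat m :=
  if t ≤ 0 then W x else ∫ y : EuclideanSpace ℝ (Fin m), heatKernel m ε t y • W (x - toTorus y)

/-- The solution operator `e^{t (ε² Δ - κ)}`. -/
def linearFlow {m : ℕ} (ε κ t : ℝ) (W : UnitAddTorus (Fin m) → Mat m)
    (x : UnitAddTorus (Fin m)) : Mat m :=
  Real.exp (-κ * t) • heatFlow ε t W x

/-- `U` is a mild solution on `[0, T]` of `U_t + κ U = ε² Δ U + N[U]` with periodic boundary
condition and initial value `U₀`, i.e. it satisfies Duhamel's formula
`U(t) = e^{t(ε²Δ - κ)} U₀ + ∫₀ᵗ e^{(t-s)(ε²Δ - κ)} N[U(s)] ds`.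
On the range of integration `s ∈ [0, T]`, so that `Set.projIcc 0 T hT s` is `s`. -/
def IsMildSolution {m : ℕ} (ε κ : ℝ) {T : ℝ} (hT : 0 ≤ T) (U₀ : PeriodicField m)
    (U : Set.Icc (0 : ℝ) T → PeriodicField m) : Prop :=
  ∀ (t : Set.Icc (0 : ℝ) T) (x : UnitAddTorus (Fin m)),
    U t x = linearFlow ε κ t U₀ x +
      ∫ s in (0 : ℝ)..t,
        linearFlow ε κ (t - s) (fun z => stabilizedReaction κ (U (Set.projIcc 0 T hT s) z)) x

end MatrixAllenCahn

end

/-! Two facts make Duhamel's map preserve the ball of radius `√m`. The heat flow is an average of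
translates, `W ↦ E[W(x - √t Z)]` with `Z` Gaussian, so it does not increase the sup norm. And `‖V‖ ≤
√m` implies `‖N[V]‖ ≤ κ√m` (`norm_stabilizedReaction_le`), so that `e^{-κt}√m + ∫₀ᵗ e^{-κ(t-s)} κ√m
ds = √m`. On this ball `N` is Lipschitz with some constant `L`, so the `n`-th Picard iterate has
Lipschitz constant `(LT)^n / n!`. Some iterate is therefore a contraction, whatever `T` is, and
Banach's theorem gives the unique mild solution (`existsUnique_eq_duhamel`). -/

open MeasureTheory Set Function NNReal

noncomputable section

namespace MatrixAllenCahn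

/-! ### Duhamel's formula for averages over random shifts -/

/-- The average of `W` over the random points `φ t z x`, where `z` has distribution `μ`. -/
def shiftAverage {X Ω E : Type*} [MeasurableSpace Ω] [NormedAddCommGroup E] [NormedSpace ℝ E]
    (μ : Measure Ω) (φ : ℝ → Ω → X → X) (t : ℝ) (W : X → E) (x : X) : E :=
  ∫ z, W (φ t z x) ∂μ

/-- The set of fields bounded by `R`. -/
def fieldBall (X E : Type*) [TopologicalSpace X] [NormedAddCommGroup E] (R : ℝ) : Set C(X, E) :=
  {W | ∀ x, ‖W x‖ ≤ R}

theorem isClosed_fieldBall (X E : Type*) [TopologicalSpace X] [NormedAddCommGroup E] (R : ℝ) :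
    IsClosed (fieldBall X E R) := by
  simp only [fieldBall, ofPred_forall]
  exact isClosed_iInter fun x =>
    isClosed_le (ContinuousEvalConst.continuous_eval_const x).norm continuous_const

/-- The right-hand side of Duhamel's formula. -/
def duhamel {X Ω E : Type*} [TopologicalSpace X] [MeasurableSpace Ω] [NormedAddCommGroup E]
    [NormedSpace ℝ E] (μ : Measure Ω) (φ : ℝ → Ω → X → X) (N : E → E) (κ : ℝ) {R T : ℝ} (hT : 0 ≤ T)
    (u₀ : C(X, E)) (U : C(Icc (0 : ℝ) T, fieldBall X E R)) (t : ℝ) (x : X) : E :=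
  Real.exp (-κ * t) • shiftAverage μ φ t u₀ x +
    ∫ s in (0 : ℝ)..t, Real.exp (-κ * (t - s)) •
      shiftAverage μ φ (t - s) (fun z => N ((U (projIcc 0 T hT s) : C(X, E)) z)) x

section Duhamel

set_option linter.unusedSectionVars false

variable {X Ω E : Type*} [TopologicalSpace X] [CompactSpace X] [FirstCountableTopology X]
  [TopologicalSpace Ω] [SecondCountableTopology Ω] [MeasurableSpace Ω] [OpensMeasurableSpace Ω]
  [NormedAddCommGroup E] [NormedSpace ℝ E]
  {μ : Measure Ω} [IsProbabilityMeasure μ] {φ : ℝ → Ω → X → X} {N : E → E} {κ R T : ℝ} {L : ℝ≥0}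

theorem norm_shiftAverage_le {W : X → E} {C : ℝ} (h : ∀ x, ‖W x‖ ≤ C) (t : ℝ) (x : X) :
    ‖shiftAverage μ φ t W x‖ ≤ C := by
  simpa [shiftAverage] using norm_integral_le_of_norm_le_const (μ := μ)
    (Filter.Eventually.of_forall fun z => h (φ t z x))

theorem integrable_comp_shift (hφ : Continuous fun p : ℝ × Ω × X => φ p.1 p.2.1 p.2.2)
    {W : X → E} (hW : Continuous W) (t : ℝ) (x : X) :
    Integrable (fun z => W (φ t z x)) μ := by
  obtain ⟨C, hC⟩ := (isCompact_range hW).isBounded.exists_norm_le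
  have hc : Continuous fun z => W (φ t z x) :=
    hW.comp (hφ.comp (by fun_prop : Continuous fun z : Ω => (t, z, x)))
  exact Integrable.of_bound hc.aestronglyMeasurable C
    (Filter.Eventually.of_forall fun z => hC _ (mem_range_self _))

/-- Dominated convergence with a constant bound. The time lag and the time of the field are separate
variables because Duhamel's integrand uses `t - s` and `s`. -/
theorem continuous_shiftAverage (hφ : Continuous fun p : ℝ × Ω × X => φ p.1 p.2.1 p.2.2)
    {W : ℝ × X → E} (hW : Continuous W) {C : ℝ} (hC : ∀ p, ‖W p‖ ≤ C) :
    Continuous fun q : ℝ × ℝ × X => shiftAverage μ φ q.1 (fun x => W (q.2.1, x)) q.2.2 := by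
  refine continuous_of_dominated (bound := fun _ => C) (fun q => ?_)
    (fun q => Filter.Eventually.of_forall fun z => hC _) (integrable_const C)
    (Filter.Eventually.of_forall fun z => ?_)
  · refine Continuous.aestronglyMeasurable (hW.comp (continuous_const.prodMk ?_))
    exact hφ.comp (by fun_prop : Continuous fun z : Ω => (q.1, z, q.2.2))
  · refine hW.comp ((by fun_prop : Continuous fun q : ℝ × ℝ × X => q.2.1).prodMk ?_)
    exact hφ.comp (by fun_prop : Continuous fun q : ℝ × ℝ × X => (q.1, z, q.2.2))

theorem continuous_field_comp (hN : LipschitzOnWith L N (Metric.closedBall 0 R)) (hT : 0 ≤ T)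
    (U : C(Icc (0 : ℝ) T, fieldBall X E R)) :
    Continuous fun p : ℝ × X => N ((U (projIcc 0 T hT p.1) : C(X, E)) p.2) := by
  refine hN.continuousOn.comp_continuous ?_ fun p => by
    simpa using (U (projIcc 0 T hT p.1)).2 p.2
  exact (continuous_subtype_val.comp (U.continuous.comp
    (continuous_projIcc.comp continuous_fst))).eval continuous_snd

theorem continuous_duhamel_integrand (hφ : Continuous fun p : ℝ × Ω × X => φ p.1 p.2.1 p.2.2)
    (hN : LipschitzOnWith L N (Metric.closedBall 0 R))
    (hNb : ∀ v, ‖v‖ ≤ R → ‖N v‖ ≤ κ * R) (hT : 0 ≤ T)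
    (U : C(Icc (0 : ℝ) T, fieldBall X E R)) :
    Continuous fun q : (ℝ × X) × ℝ => Real.exp (-κ * (q.1.1 - q.2)) •
      shiftAverage μ φ (q.1.1 - q.2)
        (fun z => N ((U (projIcc 0 T hT q.2) : C(X, E)) z)) q.1.2 := by
  have h := continuous_shiftAverage (μ := μ) hφ (continuous_field_comp hN hT U)
    (fun p => hNb _ ((U (projIcc 0 T hT p.1)).2 p.2))
  refine Continuous.smul (by fun_prop) ?_
  exact h.comp (by fun_prop : Continuous fun q : (ℝ × X) × ℝ => (q.1.1 - q.2, q.2, q.1.2))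

theorem continuous_duhamel (hφ : Continuous fun p : ℝ × Ω × X => φ p.1 p.2.1 p.2.2)
    (hN : LipschitzOnWith L N (Metric.closedBall 0 R))
    (hNb : ∀ v, ‖v‖ ≤ R → ‖N v‖ ≤ κ * R) (hT : 0 ≤ T) {u₀ : C(X, E)} (hu₀ : u₀ ∈ fieldBall X E R)
    (U : C(Icc (0 : ℝ) T, fieldBall X E R)) :
    Continuous fun p : ℝ × X => duhamel μ φ N κ hT u₀ U p.1 p.2 := by
  refine Continuous.add (Continuous.smul (by fun_prop) ?_) ?_
  · have h := continuous_shiftAverage (μ := μ) hφ (u₀.continuous.comp continuous_snd)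
      (fun p : ℝ × X => hu₀ p.2)
    exact h.comp (by fun_prop : Continuous fun p : ℝ × X => (p.1, (0 : ℝ), p.2))
  · exact intervalIntegral.continuous_parametric_intervalIntegral_of_continuous
      (continuous_duhamel_integrand hφ hN hNb hT U) continuous_fst

/-- The weights `e^{-κt}` and `κ e^{-κ(t-s)} ds` have total mass one, and both `u₀` and `N(U) / κ`
are bounded by `R`. -/
theorem norm_duhamel_le (hNb : ∀ v, ‖v‖ ≤ R → ‖N v‖ ≤ κ * R) (hT : 0 ≤ T)
    {u₀ : C(X, E)} (hu₀ : u₀ ∈ fieldBall X E R) (U : C(Icc (0 : ℝ) T, fieldBall X E R))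
    {t : ℝ} (ht : 0 ≤ t) (x : X) :
    ‖duhamel μ φ N κ hT u₀ U t x‖ ≤ R := by
  have hexp : ∀ s, HasDerivAt (fun s => R * Real.exp (-κ * (t - s)))
      (Real.exp (-κ * (t - s)) * (κ * R)) s := fun s => by
    have h := ((((hasDerivAt_id s).const_sub t).const_mul (-κ)).exp).const_mul R
    exact h.congr_deriv (by simp; ring)
  have hint : ∫ s in (0 : ℝ)..t, Real.exp (-κ * (t - s)) * (κ * R)
      = R - R * Real.exp (-κ * t) := by
    rw [intervalIntegral.integral_eq_sub_of_hasDerivAt (fun s _ => hexp s)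
      ((by fun_prop : Continuous fun s => Real.exp (-κ * (t - s)) * (κ * R)).intervalIntegrable _ _)]
    simp
  have h1 : ‖Real.exp (-κ * t) • shiftAverage μ φ t u₀ x‖ ≤ R * Real.exp (-κ * t) := by
    rw [norm_smul, Real.norm_of_nonneg (Real.exp_pos _).le, mul_comm]
    gcongr
    exact norm_shiftAverage_le hu₀ t x
  have h2 : ‖∫ s in (0 : ℝ)..t, Real.exp (-κ * (t - s)) •
      shiftAverage μ φ (t - s) (fun z => N ((U (projIcc 0 T hT s) : C(X, E)) z)) x‖
      ≤ R - R * Real.exp (-κ * t) := by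
    rw [← hint]
    refine intervalIntegral.norm_integral_le_of_norm_le ht
      (Filter.Eventually.of_forall fun s _ => ?_)
      ((by fun_prop : Continuous fun s => Real.exp (-κ * (t - s)) * (κ * R)).intervalIntegrable _ _)
    rw [norm_smul, Real.norm_of_nonneg (Real.exp_pos _).le]
    gcongr
    exact norm_shiftAverage_le (fun z => hNb _ ((U _).2 z)) _ _
  exact (norm_add_le_of_le h1 h2).trans_eq (by ring)

/-- The bound `g` is kept as a function of time, not replaced by its supremum, so that iteration
produces the factorial. -/
theorem norm_duhamel_sub_le (hφ : Continuous fun p : ℝ × Ω × X => φ p.1 p.2.1 p.2.2)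
    (hκ : 0 ≤ κ) (hN : LipschitzOnWith L N (Metric.closedBall 0 R))
    (hNb : ∀ v, ‖v‖ ≤ R → ‖N v‖ ≤ κ * R) (hT : 0 ≤ T) (u₀ : C(X, E))
    (U V : C(Icc (0 : ℝ) T, fieldBall X E R)) {g : ℝ → ℝ} (hg : Continuous g)
    (hUV : ∀ (s : Icc (0 : ℝ) T) (x : X), ‖(U s : C(X, E)) x - (V s : C(X, E)) x‖ ≤ g s)
    (t : Icc (0 : ℝ) T) (x : X) :
    ‖duhamel μ φ N κ hT u₀ U t x - duhamel μ φ N κ hT u₀ V t x‖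
      ≤ ∫ s in (0 : ℝ)..t, L * g s := by
  have hI : ∀ W : C(Icc (0 : ℝ) T, fieldBall X E R), IntervalIntegrable
      (fun s => Real.exp (-κ * (t - s)) • shiftAverage μ φ (t - s)
        (fun z => N ((W (projIcc 0 T hT s) : C(X, E)) z)) x) volume 0 t := fun W =>
    ((continuous_duhamel_integrand (μ := μ) hφ hN hNb hT W).comp
      (by fun_prop : Continuous fun s : ℝ => (((t : ℝ), x), s))).intervalIntegrable _ _
  have hc : ∀ (W : C(Icc (0 : ℝ) T, fieldBall X E R)) (s : ℝ), Continuous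
      fun z => N ((W (projIcc 0 T hT s) : C(X, E)) z) := fun W s =>
    (continuous_field_comp hN hT W).comp (by fun_prop : Continuous fun z : X => (s, z))
  rw [duhamel, duhamel, add_sub_add_left_eq_sub, ← intervalIntegral.integral_sub (hI U) (hI V)]
  refine intervalIntegral.norm_integral_le_of_norm_le t.2.1
    (Filter.Eventually.of_forall fun s hs => ?_)
    ((continuous_const.mul hg).intervalIntegrable _ _)
  rw [← smul_sub, norm_smul, Real.norm_of_nonneg (Real.exp_pos _).le]
  have hs' : s ∈ Icc (0 : ℝ) T := ⟨hs.1.le, hs.2.trans t.2.2⟩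
  have he : Real.exp (-κ * (t - s)) ≤ 1 := by
    rw [Real.exp_le_one_iff]
    nlinarith [hs.2]
  have hd : ‖shiftAverage μ φ (t - s) (fun z => N ((U (projIcc 0 T hT s) : C(X, E)) z)) x
      - shiftAverage μ φ (t - s) (fun z => N ((V (projIcc 0 T hT s) : C(X, E)) z)) x‖
      ≤ L * g s := by
    rw [shiftAverage, shiftAverage, ← integral_sub (integrable_comp_shift hφ (hc U s) _ _)
      (integrable_comp_shift hφ (hc V s) _ _)]
    refine norm_shiftAverage_le (W := fun z => N ((U (projIcc 0 T hT s) : C(X, E)) z)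
      - N ((V (projIcc 0 T hT s) : C(X, E)) z)) (fun z => ?_) _ _
    refine (hN.norm_sub_le (by simpa using (U _).2 z) (by simpa using (V _).2 z)).trans ?_
    gcongr
    simpa [projIcc_of_mem hT hs'] using hUV ⟨s, hs'⟩ z
  calc _ ≤ 1 * (L * g s) := by gcongr
    _ = _ := one_mul _

/-- The map whose fixed points are the mild solutions. -/
def picardMap (hφ : Continuous fun p : ℝ × Ω × X => φ p.1 p.2.1 p.2.2)
    (hN : LipschitzOnWith L N (Metric.closedBall 0 R))
    (hNb : ∀ v, ‖v‖ ≤ R → ‖N v‖ ≤ κ * R) (hT : 0 ≤ T) {u₀ : C(X, E)} (hu₀ : u₀ ∈ fieldBall X E R)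
    (U : C(Icc (0 : ℝ) T, fieldBall X E R)) : C(Icc (0 : ℝ) T, fieldBall X E R) :=
  -- Currying turns joint continuity in `(t, x)` into continuity in `t` for the sup norm.
  let F : C(Icc (0 : ℝ) T × X, E) := ⟨fun p => duhamel μ φ N κ hT u₀ U p.1 p.2,
    (continuous_duhamel hφ hN hNb hT hu₀ U).comp
      (by fun_prop : Continuous fun p : Icc (0 : ℝ) T × X => ((p.1 : ℝ), p.2))⟩
  ⟨fun t => ⟨F.curry t, fun x => norm_duhamel_le hNb hT hu₀ U t.2.1 x⟩,
    F.curry.continuous.subtype_mk _⟩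

theorem norm_iterate_picardMap_sub_le
    (hφ : Continuous fun p : ℝ × Ω × X => φ p.1 p.2.1 p.2.2)
    (hκ : 0 ≤ κ) (hN : LipschitzOnWith L N (Metric.closedBall 0 R))
    (hNb : ∀ v, ‖v‖ ≤ R → ‖N v‖ ≤ κ * R) (hT : 0 ≤ T) {u₀ : C(X, E)} (hu₀ : u₀ ∈ fieldBall X E R)
    (U V : C(Icc (0 : ℝ) T, fieldBall X E R)) (n : ℕ) (t : Icc (0 : ℝ) T) (x : X) :
    ‖(((picardMap (μ := μ) hφ hN hNb hT hu₀)^[n] U t : C(X, E)) x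
      - ((picardMap (μ := μ) hφ hN hNb hT hu₀)^[n] V t : C(X, E)) x)‖
      ≤ (L * t) ^ n / n.factorial * dist U V := by
  induction n generalizing t x with
  | zero =>
    simp only [iterate_zero, id, pow_zero, Nat.factorial_zero, Nat.cast_one, div_one, one_mul]
    rw [← dist_eq_norm]
    exact (ContinuousMap.dist_apply_le_dist x).trans
      ((Subtype.dist_eq _ _).symm.le.trans (ContinuousMap.dist_apply_le_dist t))
  | succ n ih =>
    rw [iterate_succ_apply', iterate_succ_apply']
    refine (norm_duhamel_sub_le (μ := μ) (g := fun s => (L * s) ^ n / n.factorial * dist U V)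
      hφ hκ hN hNb hT u₀ _ _ (by fun_prop) ih t x).trans_eq ?_
    have h : (fun s : ℝ => (L : ℝ) * ((L * s) ^ n / n.factorial * dist U V))
        = fun s => ((L : ℝ) ^ (n + 1) / n.factorial * dist U V) * s ^ n := by
      funext s
      ring
    rw [h, intervalIntegral.integral_const_mul, integral_pow, Nat.factorial_succ]
    push_cast
    field_simp
    ring

/-- Duhamel's formula has exactly one solution among the continuous curves of fields bounded by
`R`, when the nonlinearity is Lipschitz on the ball of radius `R` and maps it into the ball of
radius `κ R`. -/
theorem existsUnique_eq_duhamel [CompleteSpace E]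
    (hφ : Continuous fun p : ℝ × Ω × X => φ p.1 p.2.1 p.2.2)
    (hκ : 0 ≤ κ) (hN : LipschitzOnWith L N (Metric.closedBall 0 R))
    (hNb : ∀ v, ‖v‖ ≤ R → ‖N v‖ ≤ κ * R) (hT : 0 ≤ T) {u₀ : C(X, E)}
    (hu₀ : u₀ ∈ fieldBall X E R) :
    ∃! U : C(Icc (0 : ℝ) T, fieldBall X E R), ∀ (t : Icc (0 : ℝ) T) (x : X),
      (U t : C(X, E)) x = duhamel μ φ N κ hT u₀ U t x := by
  set Φ := picardMap (μ := μ) hφ hN hNb hT hu₀ with hΦ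
  have hfix : ∀ U : C(Icc (0 : ℝ) T, fieldBall X E R), (∀ (t : Icc (0 : ℝ) T) (x : X),
      (U t : C(X, E)) x = duhamel μ φ N κ hT u₀ U t x) ↔ IsFixedPt Φ U := fun U => by
    refine ⟨fun h => ?_, fun h t x => ?_⟩
    · ext t x
      exact (h t x).symm
    · exact (congrArg (fun V : C(Icc (0 : ℝ) T, fieldBall X E R) => (V t : C(X, E)) x) h).symm
  simp_rw [hfix]
  have : CompleteSpace (fieldBall X E R) := (isClosed_fieldBall X E R).completeSpace_coe
  have : Nonempty C(Icc (0 : ℝ) T, fieldBall X E R) := ⟨.const _ ⟨u₀, hu₀⟩⟩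
  -- The factorial beats the power, so no smallness of `T` is needed.
  obtain ⟨n, hn⟩ := ((FloorSemiring.tendsto_pow_div_factorial_atTop ((L : ℝ) * T)).eventually
    (gt_mem_nhds one_pos)).exists
  have hLT : 0 ≤ ((L : ℝ) * T) ^ n / n.factorial := by positivity
  have hcontr : ContractingWith (((L : ℝ) * T) ^ n / n.factorial).toNNReal Φ^[n] := by
    refine ⟨Real.toNNReal_lt_one.2 hn, LipschitzWith.of_dist_le_mul fun U V => ?_⟩
    rw [Real.coe_toNNReal _ hLT]
    refine (ContinuousMap.dist_le (by positivity)).2 fun t => ?_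
    refine (Subtype.dist_eq _ _).le.trans ((ContinuousMap.dist_le (by positivity)).2 fun x => ?_)
    rw [dist_eq_norm]
    refine (norm_iterate_picardMap_sub_le (μ := μ) hφ hκ hN hNb hT hu₀ U V n t x).trans ?_
    have ht := t.2.1
    have ht' := t.2.2
    gcongr
  -- The fixed point of `Φ^[n]` is also fixed by `Φ`, and every fixed point of `Φ` is fixed by
  -- `Φ^[n]`.
  exact ⟨_, hcontr.isFixedPt_fixedPoint_iterate, fun V hV =>
    hcontr.fixedPoint_unique (hV.iterate n)⟩

end Duhamel

/-! ### Frobenius norm estimates for the nonlinearity -/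

theorem frobenius_norm_sq_eq_trace {m : ℕ} (A : Mat m) : ‖A‖ ^ 2 = (A.transpose * A).trace := by
  rw [Matrix.frobenius_norm_def, ← Real.sqrt_eq_rpow,
    Real.sq_sqrt (by positivity), Matrix.trace, Finset.sum_comm]
  simp [Matrix.mul_apply, Matrix.diag, pow_two]

/-- With `P = VᵀV`, expand `κV - V(P - 1)`; the cross term is `tr(P(P - 1)) = ‖P - 1‖² + ‖V‖² - m`.
-/
theorem norm_stabilizedReaction_sq {m : ℕ} (κ : ℝ) (V : Mat m) :
    ‖stabilizedReaction κ V‖ ^ 2 = κ ^ 2 * m + κ * (κ - 2) * (‖V‖ ^ 2 - m)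
      - 2 * κ * ‖V.transpose * V - 1‖ ^ 2 + ‖V * (V.transpose * V - 1)‖ ^ 2 := by
  set P := V.transpose * V with hP
  have hPt : P.transpose = P := by simp [hP]
  have h0 : stabilizedReaction κ V = V * ((κ + 1) • 1 - P) := by
    rw [mul_sub, Matrix.mul_smul, mul_one, hP, ← Matrix.mul_assoc, add_smul, one_smul,
      stabilizedReaction, reaction, add_sub_assoc]
  have h1 : (1 : Mat m).trace = m := by simp
  have e : ∀ Q : Mat m, ‖V * Q‖ ^ 2 = (Q.transpose * (P * Q)).trace := fun Q => by
    rw [frobenius_norm_sq_eq_trace, hP, Matrix.transpose_mul]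
    simp only [Matrix.mul_assoc]
  rw [h0, e, e, frobenius_norm_sq_eq_trace V, frobenius_norm_sq_eq_trace (P - 1), ← hP, ← h1]
  simp only [Matrix.transpose_sub, hPt, Matrix.transpose_smul, Matrix.transpose_one, mul_sub,
    sub_mul, Matrix.trace_sub, Matrix.trace_smul, Matrix.smul_mul, Matrix.mul_smul, mul_one,
    one_mul, smul_eq_mul]
  ring

/-- In the identity above, `κ ≥ 2` makes the second term nonpositive, and `‖V‖² ≤ m ≤ 2κ` lets the
third absorb the last. -/
theorem norm_stabilizedReaction_le {m : ℕ} {κ : ℝ} (hκm : (m : ℝ) ≤ 2 * κ) (hκ : 2 ≤ κ)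
    {V : Mat m} (hV : ‖V‖ ≤ √m) : ‖stabilizedReaction κ V‖ ≤ κ * √m := by
  have hm : (0 : ℝ) ≤ m := m.cast_nonneg
  have hV2 : ‖V‖ ^ 2 ≤ (m : ℝ) := (Real.le_sqrt (norm_nonneg V) hm).1 hV
  refine abs_le_of_sq_le_sq' ?_ (by positivity) |>.2
  rw [norm_stabilizedReaction_sq, mul_pow, Real.sq_sqrt hm]
  have h1 : ‖V * (V.transpose * V - 1)‖ ^ 2 ≤ 2 * κ * ‖V.transpose * V - 1‖ ^ 2 := by
    calc _ ≤ (‖V‖ * ‖V.transpose * V - 1‖) ^ 2 := by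
          gcongr
          exact Matrix.frobenius_norm_mul _ _
      _ = ‖V‖ ^ 2 * ‖V.transpose * V - 1‖ ^ 2 := mul_pow _ _ _
      _ ≤ _ := by gcongr; exact hV2.trans hκm
  have h2 : κ * (κ - 2) * (‖V‖ ^ 2 - m) ≤ 0 :=
    mul_nonpos_of_nonneg_of_nonpos (mul_nonneg (by linarith) (by linarith)) (by linarith)
  linarith

theorem norm_stabilizedReaction_sub_le {m : ℕ} {κ : ℝ} (hκ : 0 ≤ κ) {V W : Mat m}
    (hV : ‖V‖ ≤ √m) (hW : ‖W‖ ≤ √m) :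
    ‖stabilizedReaction κ V - stabilizedReaction κ W‖ ≤ (κ + 1 + 3 * m) * ‖V - W‖ := by
  have hm : (0 : ℝ) ≤ m := m.cast_nonneg
  have h3 : ∀ A B C : Mat m, ‖A * B * C‖ ≤ ‖A‖ * ‖B‖ * ‖C‖ := fun A B C =>
    (Matrix.frobenius_norm_mul _ _).trans (by gcongr; exact Matrix.frobenius_norm_mul _ _)
  have ht : ∀ A : Mat m, ‖A.transpose‖ = ‖A‖ := Matrix.frobenius_norm_transpose
  -- Telescoping the cubic term changes one factor at a time; each of the three differences costs `m
  -- ‖V - W‖`.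
  have e : stabilizedReaction κ V - stabilizedReaction κ W = (κ + 1) • (V - W)
      - ((V - W) * V.transpose * V + W * (V - W).transpose * V
        + W * W.transpose * (V - W)) := by
    simp only [stabilizedReaction, reaction, Matrix.transpose_sub, mul_sub, sub_mul, add_smul,
      smul_sub, one_smul]
    abel
  have hd := norm_nonneg (V - W)
  have b : ∀ {a b c : ℝ}, 0 ≤ a → 0 ≤ b → a ≤ √m → b ≤ √m → 0 ≤ c → a * b * c ≤ m * c := by
    intro a b c ha hb ha' hb' hc
    gcongr
    exact (mul_le_mul ha' hb' hb (Real.sqrt_nonneg _)).trans_eq (Real.mul_self_sqrt hm)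
  have b1 : ‖(V - W) * V.transpose * V‖ ≤ m * ‖V - W‖ := by
    refine (h3 _ _ _).trans ?_
    rw [ht, mul_assoc, mul_comm]
    exact b (norm_nonneg _) (norm_nonneg _) hV hV hd
  have b2 : ‖W * (V - W).transpose * V‖ ≤ m * ‖V - W‖ := by
    refine (h3 _ _ _).trans ?_
    rw [ht, mul_right_comm]
    exact b (norm_nonneg _) (norm_nonneg _) hW hV hd
  have b3 : ‖W * W.transpose * (V - W)‖ ≤ m * ‖V - W‖ := by
    refine (h3 _ _ _).trans ?_
    rw [ht]
    exact b (norm_nonneg _) (norm_nonneg _) hW hW hd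
  rw [e]
  refine (norm_sub_le _ _).trans ?_
  have b0 : ‖(κ + 1) • (V - W)‖ = (κ + 1) * ‖V - W‖ := by
    rw [norm_smul, Real.norm_of_nonneg (by positivity)]
  have := norm_add₃_le (a := (V - W) * V.transpose * V) (b := W * (V - W).transpose * V)
    (c := W * W.transpose * (V - W))
  linarith

theorem lipschitzOnWith_stabilizedReaction {m : ℕ} {κ : ℝ} (hκ : 0 ≤ κ) :
    LipschitzOnWith (κ + 1 + 3 * m).toNNReal (stabilizedReaction (m := m) κ)
      (Metric.closedBall 0 (√m)) := by
  refine LipschitzOnWith.of_dist_le_mul fun V hV W hW => ?_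
  rw [dist_eq_norm, dist_eq_norm, Real.coe_toNNReal _ (by positivity)]
  exact norm_stabilizedReaction_sub_le hκ (by simpa using hV) (by simpa using hW)

/-! ### The heat flow as a Gaussian average -/

theorem continuous_toTorus {m : ℕ} : Continuous (toTorus (m := m)) :=
  continuous_pi fun i => (AddCircle.continuous_mk' (1 : ℝ)).comp (by fun_prop)

theorem heatKernel_pos (m : ℕ) {ε t : ℝ} (hε : 0 < ε) (ht : 0 < t)
    (y : EuclideanSpace ℝ (Fin m)) : 0 < heatKernel m ε t y := by
  unfold heatKernel
  positivity

theorem continuous_heatKernel (m : ℕ) (ε t : ℝ) : Continuous (heatKernel m ε t) := by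
  unfold heatKernel
  fun_prop

/-- Parabolic scaling: it moves the time dependence from the kernel to the shift, leaving one fixed
measure. -/
theorem heatKernel_sqrt_smul (m : ℕ) {ε t : ℝ} (hε : 0 < ε) (ht : 0 < t)
    (y : EuclideanSpace ℝ (Fin m)) :
    √t ^ m * heatKernel m ε t (√t • y) = heatKernel m ε 1 y := by
  have h1 : √t ^ m = t ^ ((m : ℝ) / 2) := by
    rw [Real.sqrt_eq_rpow, ← Real.rpow_natCast, ← Real.rpow_mul ht.le]
    ring_nf
  have h2 : (4 * Real.pi * ε ^ 2 * t) ^ (-(m : ℝ) / 2)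
      = (4 * Real.pi * ε ^ 2 * 1) ^ (-(m : ℝ) / 2) * t ^ (-(m : ℝ) / 2) := by
    rw [Real.mul_rpow (by positivity) ht.le, mul_one]
  have h3 : t ^ ((m : ℝ) / 2) * t ^ (-(m : ℝ) / 2) = 1 := by
    rw [← Real.rpow_add ht, show (m : ℝ) / 2 + -(m : ℝ) / 2 = 0 by ring, Real.rpow_zero]
  have h4 : -‖√t • y‖ ^ 2 / (4 * ε ^ 2 * t) = -‖y‖ ^ 2 / (4 * ε ^ 2 * 1) := by
    rw [norm_smul, mul_pow, Real.norm_of_nonneg (Real.sqrt_nonneg _), Real.sq_sqrt ht.le]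
    field_simp
  rw [heatKernel, heatKernel, h4, h1, h2]
  linear_combination (4 * Real.pi * ε ^ 2 * 1) ^ (-(m : ℝ) / 2)
    * Real.exp (-‖y‖ ^ 2 / (4 * ε ^ 2 * 1)) * h3

/-- The Gaussian law with density `heatKernel m ε 1`. -/
def heatMeasure (m : ℕ) (ε : ℝ) : Measure (EuclideanSpace ℝ (Fin m)) :=
  volume.withDensity fun y => ENNReal.ofReal (heatKernel m ε 1 y)

theorem isProbabilityMeasure_heatMeasure (m : ℕ) {ε : ℝ} (hε : 0 < ε) :
    IsProbabilityMeasure (heatMeasure m ε) := by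
  have h := integral_heatKernel m hε one_pos
  have hi : Integrable (heatKernel m ε 1) := by
    -- A nonintegrable function has integral `0` by default, which contradicts total mass one.
    by_contra hi
    simp [integral_undef hi] at h
  refine ⟨?_⟩
  rw [heatMeasure, withDensity_apply _ MeasurableSet.univ, Measure.restrict_univ,
    ← ofReal_integral_eq_lintegral_ofReal hi
      (Filter.Eventually.of_forall fun y => (heatKernel_pos m hε one_pos y).le), h,
    ENNReal.ofReal_one]

theorem integral_heatMeasure {E : Type*} [NormedAddCommGroup E] [NormedSpace ℝ E] (m : ℕ) {ε : ℝ}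
    (hε : 0 < ε) (F : EuclideanSpace ℝ (Fin m) → E) :
    ∫ y, F y ∂heatMeasure m ε = ∫ y, heatKernel m ε 1 y • F y := by
  rw [heatMeasure, integral_withDensity_eq_integral_toReal_smul
    (continuous_heatKernel m ε 1).measurable.ennreal_ofReal (by simp)]
  simp_rw [ENNReal.toReal_ofReal (heatKernel_pos m hε one_pos _).le]

theorem integral_heatKernel_smul {E : Type*} [NormedAddCommGroup E] [NormedSpace ℝ E] (m : ℕ)
    {ε t : ℝ} (hε : 0 < ε) (ht : 0 < t) (F : EuclideanSpace ℝ (Fin m) → E) :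
    ∫ y, heatKernel m ε t y • F y = ∫ y, F (√t • y) ∂heatMeasure m ε := by
  rw [integral_heatMeasure m hε]
  have h := Measure.integral_comp_smul_of_nonneg volume (fun y => heatKernel m ε t y • F y)
    (√t) (hR := Real.sqrt_nonneg t)
  rw [finrank_euclideanSpace_fin] at h
  have hpos : √t ^ m ≠ 0 := (pow_pos (Real.sqrt_pos.2 ht) m).ne'
  simp_rw [← heatKernel_sqrt_smul m hε ht, mul_smul]
  rw [integral_smul, h, smul_inv_smul₀ hpos]

/-- For `t ≤ 0`, `√t` is `0` and the average is over trivial shifts, so one formula covers every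
real `t` and is continuous through `t = 0`. -/
theorem heatFlow_eq_integral {m : ℕ} {ε : ℝ} (hε : 0 < ε) (t : ℝ)
    (W : UnitAddTorus (Fin m) → Mat m) (x : UnitAddTorus (Fin m)) :
    heatFlow ε t W x = ∫ z, W (x - toTorus (√t • z)) ∂heatMeasure m ε := by
  unfold heatFlow
  split_ifs with ht
  · have := isProbabilityMeasure_heatMeasure m hε
    have h0 : toTorus (0 : EuclideanSpace ℝ (Fin m)) = 0 := by
      funext i
      simp [toTorus]
    simp [Real.sqrt_eq_zero_of_nonpos ht, h0]
  · exact integral_heatKernel_smul m hε (not_le.1 ht) fun y => W (x - toTorus y)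

end MatrixAllenCahn

end

open MatrixAllenCahn in
theorem mainTheorem4 (m : ℕ) (hm : 2 ≤ m) (ε κ T : ℝ) (hε : 0 < ε) (hT : 0 < T)
    (hκ : max (3 / 2 * (m : ℝ) - 1) 2 ≤ κ)
    (U₀ : MatrixAllenCahn.PeriodicField m) (hU₀ : U₀ ∈ MatrixAllenCahn.boundedFields m) :
    (∃! U : C(Set.Icc (0 : ℝ) T, MatrixAllenCahn.boundedFields m),
      MatrixAllenCahn.IsMildSolution ε κ hT.le U₀ (fun t => (U t : MatrixAllenCahn.PeriodicField m))) ∧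
    ∀ U : C(Set.Icc (0 : ℝ) T, MatrixAllenCahn.boundedFields m),
      MatrixAllenCahn.IsMildSolution ε κ hT.le U₀ (fun t => (U t : MatrixAllenCahn.PeriodicField m)) →
      ∀ (t : Set.Icc (0 : ℝ) T) (x : UnitAddTorus (Fin m)),
        ‖(U t : MatrixAllenCahn.PeriodicField m) x‖ ≤ Real.sqrt m := by
  refine ⟨?_, fun U _ t x => (U t).2 x⟩
  have hm' : (2 : ℝ) ≤ m := by exact_mod_cast hm
  have hκ1 := (le_max_left _ _).trans hκ
  have hκ2 := (le_max_right _ _).trans hκ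
  have := isProbabilityMeasure_heatMeasure m hε
  let φ : ℝ → EuclideanSpace ℝ (Fin m) → UnitAddTorus (Fin m) → UnitAddTorus (Fin m) :=
    fun t z x => x - toTorus (√t • z)
  have hφ : Continuous fun p : ℝ × EuclideanSpace ℝ (Fin m) × UnitAddTorus (Fin m) =>
      φ p.1 p.2.1 p.2.2 :=
    continuous_snd.snd.sub (continuous_toTorus.comp (by fun_prop))
  -- The condition `m ≤ 2κ` follows from `2κ ≥ 3m - 2` and `m ≥ 2`.
  have key := existsUnique_eq_duhamel (E := Mat m) (μ := heatMeasure m ε) hφ (by linarith : 0 ≤ κ)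
    (lipschitzOnWith_stabilizedReaction (by linarith))
    (fun V hV => norm_stabilizedReaction_le (by linarith) hκ2 hV) hT.le (u₀ := U₀) hU₀
  have hflow : ∀ (t : ℝ) (W : UnitAddTorus (Fin m) → Mat m) (x : UnitAddTorus (Fin m)),
      linearFlow ε κ t W x = Real.exp (-κ * t) • shiftAverage (heatMeasure m ε) φ t W x :=
    fun t W x => by rw [linearFlow, heatFlow_eq_integral hε]; rfl
  simp only [IsMildSolution, hflow]
  exact key
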